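/- Let $\Omega\subset\mathbb R^2$ be a domain (a non-empty connected open set) and let all lengths, diameters and distances be Euclidean. For $a,b\in\Omega$ let $\lambda_\Omega(a,b)$ be the infimum of the lengths $\ell(\gamma)$ of all paths $\gamma\colon[0,1]\to\Omega$ with $\gamma(0)=a$ and $\gamma(1)=b$. For $A\ge 1$, the domain $\Omega$ is called inner $A$-uniform if for all $a,b\in\Omega$ there is a path $\gamma\colon[0,1]\to\Omega$ with $\gamma(0)=a$, $\gamma(1)=b$, such that $$\ell(\gamma)\le A\,\lambda_\Omega(a,b)\qquad\text{and}\qquad \min\{\ell(\gamma|_{[0,t]}),\ell(\gamma|_{[t,1]})\}\le A\,\operatorname{dist}(\gamma(t),\partial\Omega)\quad\text{for all } t\in[0,1]$$ (where $\operatorname{dist}(\cdot,\emptyset)=\infty$). **Theorem.** For every $A\ge 1$ there is a constant $C(A)\ge 1$, depending only on $A$, such that for every inner $A$-uniform domain $\Omega\subset\mathbb R^2$, each connected component $S$ of $\mathbb R^2\setminus\Omega$ has $C(A)$-bounded turning: for all $x,y\in S$ there is a connected set $E\subset S$ containing $x$ and $y$ with $\operatorname{diam}E\le C(A)\,|x-y|$.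 -/

import Mathlib

open scoped ENNReal

/-- The length of a curve `γ : [0,1] → X` (possibly `∞`): the supremum of the polygonal sums. -/
noncomputable def curveLength {X : Type*} [MetricSpace X] {a b : X} (γ : Path a b) : ℝ≥0∞ :=
  eVariationOn γ Set.univ

/-- The length of the restriction of the curve `γ : [0,1] → X` to `[s,t]`. -/
noncomputable def curveLengthOn {X : Type*} [MetricSpace X] {a b : X} (γ : Path a b)
    (s t : unitInterval) : ℝ≥0∞ :=
  eVariationOn γ (Set.Icc s t)

/-- The inner metric `λ_Ω(a,b)`: the infimum of the lengths of the paths in `Ω` from `a` to `b`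
(equal to `∞` if there is no such path of finite length). -/
noncomputable def innerMetric {X : Type*} [MetricSpace X] (Ω : Set X) (a b : X) : ℝ≥0∞ :=
  ⨅ (γ : Path a b) (_ : ∀ t, γ t ∈ Ω), curveLength γ

/-- `γ` is an inner `A`-uniform curve in `Ω`. Distances to the boundary take values in `[0,∞]`, so
that the second condition holds trivially when the boundary of `Ω` is empty. -/
structure IsInnerUniformCurve {X : Type*} [MetricSpace X] (A : ℝ) (Ω : Set X) {a b : X}
    (γ : Path a b) : Prop where
  mem : ∀ t, γ t ∈ Ω
  length_le : curveLength γ ≤ ENNReal.ofReal A * innerMetric Ω a b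
  cigar : ∀ t, min (curveLengthOn γ 0 t) (curveLengthOn γ t 1) ≤
    ENNReal.ofReal A * Metric.infEDist (γ t) (frontier Ω)

/-- `Ω` is an inner `A`-uniform domain: it is open, connected and non-empty, and any two of its
points are joined by an inner `A`-uniform curve. -/
structure IsInnerUniformDomain {X : Type*} [MetricSpace X] (A : ℝ) (Ω : Set X) : Prop where
  isOpen : IsOpen Ω
  isConnected : IsConnected Ω
  exists_curve : ∀ a ∈ Ω, ∀ b ∈ Ω, ∃ γ : Path a b, IsInnerUniformCurve A Ω γ

/-- The metric space `X` has `L`-bounded turning. The diameter takes values in `[0,∞]`, so that `E`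
is in particular bounded. -/
def HasBoundedTurning (L : ℝ) (X : Type*) [MetricSpace X] : Prop :=
  1 ≤ L ∧ ∀ x y : X, ∃ E : Set X, IsConnected E ∧ x ∈ E ∧ y ∈ E ∧
    Metric.ediam E ≤ ENNReal.ofReal (L * dist x y)

/-! Take `x`, `y` in one component of the complement. Then `(z - x) / (z - y)` has a continuous
logarithm `L` on `Ω`; off the segment from `x` to `y` it has the principal one, `M`. By the cigar
condition, points of `Ω` at distance at least `ρ > (A + 1) * dist x y` from `x` are joined in `Ω`
outside a disc containing the segment, so `L - M` is constant on them. Gluing `L` and a translate of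
`M` gives a logarithm off the compact set `Ωᶜ ∩ closedBall x ρ`, and by Eilenberg's criterion
(`IsLogOn.mem_connectedComponentIn`) `x` and `y` lie in one component of that set. -/

open Set Filter Topology Metric

/-! ### Continuous branches of the logarithm -/

/-- `L` is a continuous branch of the logarithm of `f` on `s`. -/
def IsLogOn (L f : ℂ → ℂ) (s : Set ℂ) : Prop :=
  ContinuousOn L s ∧ ∀ z ∈ s, Complex.exp (L z) = f z

theorem IsLogOn.mono {L f : ℂ → ℂ} {s t : Set ℂ} (h : IsLogOn L f s) (hts : t ⊆ s) :
    IsLogOn L f t :=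
  ⟨h.1.mono hts, fun z hz ↦ h.2 z (hts hz)⟩

/-- The difference is continuous with values in the discrete set `2πiℤ`. -/
theorem sub_eq_sub_of_exp_eq {X : Type*} [TopologicalSpace X] {u v : X → ℂ} {s : Set X}
    (hs : IsPreconnected s) (hu : ContinuousOn u s) (hv : ContinuousOn v s)
    (h : ∀ z ∈ s, Complex.exp (u z) = Complex.exp (v z)) {a b : X} (ha : a ∈ s) (hb : b ∈ s) :
    u a - v a = u b - v b := by
  have key : ∀ z ∈ s, ∃ n : ℤ, u z - v z = n * (2 * Real.pi * Complex.I) := fun z hz ↦ by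
    obtain ⟨n, hn⟩ := Complex.exp_eq_exp_iff_exists_int.1 (h z hz)
    exact ⟨n, by rw [hn]; ring⟩
  have hpi : (2 * Real.pi * Complex.I : ℂ) ≠ 0 := Complex.two_pi_I_ne_zero
  have hc : ContinuousOn (fun z ↦ ((u z - v z) / (2 * Real.pi * Complex.I)).re) s :=
    Complex.continuous_re.comp_continuousOn ((hu.sub hv).div_const _)
  have hT : MapsTo (fun z ↦ ((u z - v z) / (2 * Real.pi * Complex.I)).re) s
      (range ((↑) : ℤ → ℝ)) := fun z hz ↦ by
    obtain ⟨n, hn⟩ := key z hz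
    exact ⟨n, by simp only [hn, mul_div_cancel_right₀ _ hpi, Complex.intCast_re]⟩
  have hd : IsDiscrete (range ((↑) : ℤ → ℝ)) :=
    ⟨Int.isClosedEmbedding_coe_real.isEmbedding.toHomeomorph.discreteTopology⟩
  obtain ⟨r, hr⟩ := hs.eqOn_const_of_mapsTo hd hc hT ⟨_, mem_range_self 0⟩
  obtain ⟨m, hm⟩ := key a ha
  obtain ⟨n, hn⟩ := key b hb
  have := (hr.2 ha).trans (hr.2 hb).symm
  simp only [hm, hn, mul_div_cancel_right₀ _ hpi, Complex.intCast_re, Int.cast_inj] at this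
  rw [hm, hn, this]

theorem div_mem_slitPlane {x y z : ℂ} (hz : z ∉ segment ℝ x y) :
    (z - x) / (z - y) ∈ Complex.slitPlane := by
  by_contra h
  have hy : z - y ≠ 0 := sub_ne_zero.2 fun e ↦ hz (e ▸ right_mem_segment ℝ x y)
  rw [Complex.mem_slitPlane_iff, not_or, not_lt, not_not] at h
  obtain ⟨s, hs, hse⟩ : ∃ s : ℝ, 0 ≤ s ∧ (z - x) / (z - y) = -s :=
    ⟨-((z - x) / (z - y)).re, neg_nonneg.2 h.1, Complex.ext (by simp) (by simpa using h.2)⟩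
  rw [div_eq_iff hy] at hse
  have hs1 : (1 + s : ℂ) ≠ 0 := by
    exact_mod_cast (by positivity : (1 + s : ℝ) ≠ 0)
  refine hz ⟨1 / (1 + s), s / (1 + s), by positivity, by positivity, by field_simp, ?_⟩
  simp only [Complex.real_smul]
  push_cast
  field_simp
  linear_combination -hse

theorem isLogOn_log_div (x y : ℂ) :
    IsLogOn (fun z ↦ Complex.log ((z - x) / (z - y))) (fun z ↦ (z - x) / (z - y))
      (segment ℝ x y)ᶜ := by
  have hy : ∀ z ∈ (segment ℝ x y)ᶜ, z - y ≠ 0 :=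
    fun z hz ↦ sub_ne_zero.2 fun e ↦ hz (e ▸ right_mem_segment ℝ x y)
  refine ⟨ContinuousOn.clog (ContinuousOn.div (by fun_prop) (by fun_prop) hy)
    fun z hz ↦ div_mem_slitPlane hz, fun z hz ↦ Complex.exp_log ?_⟩
  exact Complex.slitPlane_ne_zero (div_mem_slitPlane hz)

/-- For `y` within `ε` of `x` the segment between them stays in the `ε`-ball, so the principal
branch works; adding logarithms chains such steps along `S`. -/
theorem IsPreconnected.exists_isLogOn_div {S : Set ℂ} (hS : IsPreconnected S) {x y : ℂ}
    (hx : x ∈ S) (hy : y ∈ S) {ε : ℝ} (hε : 0 < ε) :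
    ∃ L, IsLogOn L (fun z ↦ (z - x) / (z - y)) {z | ∀ w ∈ S, ε ≤ dist z w} := by
  refine hS.induction₂ (fun x y ↦ ∃ L, IsLogOn L (fun z ↦ (z - x) / (z - y))
    {z | ∀ w ∈ S, ε ≤ dist z w}) ?_ ?_ ?_ hx hy
  · intro x hx
    filter_upwards [mem_nhdsWithin_of_mem_nhds (ball_mem_nhds x hε)] with y hy
    refine ⟨_, (isLogOn_log_div x y).mono fun z hz hseg ↦ ?_⟩
    have h1 : z ∈ ball x ε := (convex_ball x ε).segment_subset (mem_ball_self hε) hy hseg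
    exact absurd (hz x hx) (not_le.2 h1)
  · rintro x y z - hy hz ⟨L, hL, hL'⟩ ⟨M, hM, hM'⟩
    refine ⟨fun w ↦ L w + M w, hL.add hM, fun w hw ↦ ?_⟩
    have h1 : w - y ≠ 0 := fun e ↦ by
      have := hw y hy
      rw [sub_eq_zero.1 e, dist_self] at this
      linarith
    simp only [Complex.exp_add, hL' w hw, hM' w hw]
    field_simp
  · rintro x y - - ⟨L, hL, hL'⟩
    refine ⟨fun w ↦ -L w, hL.neg, fun w hw ↦ ?_⟩
    simp only [Complex.exp_neg, hL' w hw, inv_div]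

/-- Branches of the logarithm of `h` on sets exhausting a domain can be glued to a branch on the
whole domain. -/
theorem exists_isLogOn_of_exhaustion {Ω : Set ℂ} (hΩ : IsOpen Ω) (hc : IsConnected Ω) {h : ℂ → ℂ}
    {L : ℕ → ℂ → ℂ} {s : ℕ → Set ℂ} (hL : ∀ n, IsLogOn (L n) h (s n))
    (hs : ∀ C ⊆ Ω, IsCompact C → ∀ᶠ n in atTop, C ⊆ s n) : ∃ M, IsLogOn M h Ω := by
  have hp : IsPathConnected Ω := hΩ.isConnected_iff_isPathConnected.1 hc
  obtain ⟨z₀, hz₀⟩ := hc.nonempty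
  have nb : ∀ z ∈ Ω, ∃ C ⊆ Ω, IsCompact C ∧ IsPreconnected C ∧ z₀ ∈ C ∧ C ∈ 𝓝 z := by
    intro z hz
    obtain ⟨ρ, hρ, hball⟩ := Metric.nhds_basis_closedBall.mem_iff.1 (hΩ.mem_nhds hz)
    obtain ⟨γ, hγ⟩ := hp.joinedIn z₀ hz₀ z hz
    refine ⟨range γ ∪ closedBall z ρ, union_subset (range_subset_iff.2 hγ) hball,
      (isCompact_range γ.continuous).union (isCompact_closedBall z ρ), ?_,
      Or.inl ⟨0, γ.source⟩, mem_of_superset (closedBall_mem_nhds z hρ) subset_union_right⟩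
    exact IsPreconnected.union z ⟨1, γ.target⟩ (mem_closedBall_self hρ.le)
      (isPreconnected_range γ.continuous) (convex_closedBall z ρ).isPreconnected
  have h0 : h z₀ ≠ 0 := by
    obtain ⟨n, hn⟩ := (hs {z₀} (by simpa) isCompact_singleton).exists
    rw [← (hL n).2 z₀ (hn rfl)]
    exact Complex.exp_ne_zero _
  -- A compact connected set joins `z₀` to a neighbourhood of `z`, so the branches normalised at
  -- `z₀` eventually agree there.
  have hE : ∀ z ∈ Ω, ∃ N, ∃ C ∈ 𝓝 z, ∀ n ≥ N, C ⊆ s n ∧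
      ∀ w ∈ C, L n w - L n z₀ = L N w - L N z₀ := by
    intro z hz
    obtain ⟨C, hCΩ, hCc, hCp, hz0, hCn⟩ := nb z hz
    obtain ⟨N, hN⟩ := eventually_atTop.1 (hs C hCΩ hCc)
    refine ⟨N, C, hCn, fun n hn ↦ ⟨hN n hn, fun w hw ↦ ?_⟩⟩
    have := sub_eq_sub_of_exp_eq hCp ((hL n).1.mono (hN n hn)) ((hL N).1.mono (hN N le_rfl))
      (fun u hu ↦ by rw [(hL n).2 u (hN n hn hu), (hL N).2 u (hN N le_rfl hu)]) hw hz0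
    linear_combination this
  have hz₀s : ∀ᶠ n in atTop, {z₀} ⊆ s n := hs {z₀} (by simpa) isCompact_singleton
  choose! N C hCn hNC using hE
  have hloc : ∀ z ∈ Ω, ∀ w ∈ Ω, w ∈ C z →
      L (N w) w - L (N w) z₀ = L (N z) w - L (N z) z₀ := by
    intro z hz w hw hwC
    rw [← (hNC z hz (max (N z) (N w)) (le_max_left _ _)).2 w hwC,
      (hNC w hw (max (N z) (N w)) (le_max_right _ _)).2 w (mem_of_mem_nhds (hCn w hw))]
  refine ⟨fun z ↦ L (N z) z - L (N z) z₀ + Complex.log (h z₀), fun z hz ↦ ?_, fun z hz ↦ ?_⟩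
  · refine ContinuousAt.continuousWithinAt ?_
    refine ContinuousAt.congr (f := fun w ↦ L (N z) w - L (N z) z₀ + Complex.log (h z₀)) ?_ ?_
    · have := (hL (N z)).1.continuousAt (mem_of_superset (hCn z hz) (hNC z hz _ le_rfl).1)
      fun_prop
    · filter_upwards [hCn z hz, hΩ.mem_nhds hz] with w hw hwΩ
      rw [hloc z hz w hwΩ hw]
  · obtain ⟨n, hn, hn'⟩ := (hz₀s.and (eventually_ge_atTop (N z))).exists
    have hzC := mem_of_mem_nhds (hCn z hz)
    beta_reduce
    rw [← (hNC z hz n hn').2 z hzC, Complex.exp_add, Complex.exp_sub, Complex.exp_log h0,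
      (hL n).2 z ((hNC z hz n hn').1 hzC), (hL n).2 z₀ (hn rfl), div_mul_cancel₀ _ h0]

/-- If `x` and `y` lie in a connected subset of the complement of a domain, then
`(z - x) / (z - y)` has a continuous logarithm on the domain. -/
theorem exists_isLogOn_div_of_isOpen {Ω S : Set ℂ} (hΩ : IsOpen Ω) (hc : IsConnected Ω)
    (hS : IsPreconnected S) (hSΩ : S ⊆ Ωᶜ) {x y : ℂ} (hx : x ∈ S) (hy : y ∈ S) :
    ∃ L, IsLogOn L (fun z ↦ (z - x) / (z - y)) Ω := by
  choose L hL using fun n : ℕ ↦ hS.exists_isLogOn_div hx hy (Nat.one_div_pos_of_nat (α := ℝ) (n := n))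
  refine exists_isLogOn_of_exhaustion hΩ hc hL fun C hCΩ hC ↦ ?_
  obtain ⟨δ, hδ, hδC⟩ := hC.exists_thickening_subset_open hΩ hCΩ
  obtain ⟨N, hN⟩ := exists_nat_one_div_lt hδ
  filter_upwards [eventually_ge_atTop N] with n hn z hz w hw
  refine (Nat.one_div_le_one_div hn).trans (hN.le.trans ?_)
  by_contra! hlt
  exact hSΩ hw (hδC (mem_thickening_iff.2 ⟨z, hz, by rwa [dist_comm]⟩))

/-! ### Logarithms and separation of compact sets -/

/-- Winding number: along the circle a logarithm would drop by `2πi` per turn, yet be periodic. -/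
theorem not_isLogOn_inv_sub {x : ℂ} {L f : ℂ → ℂ} {R : ℝ} (hR : 0 < R)
    (hf : ∀ z, dist z x = R → f z = (z - x)⁻¹) : ¬ IsLogOn L f (sphere x R) := by
  rintro ⟨hL, hL'⟩
  have hm : ∀ t, circleMap x R t ∈ sphere x R := circleMap_mem_sphere x hR.le
  have hR' : (R : ℂ) ≠ 0 := by exact_mod_cast hR.ne'
  have key := sub_eq_sub_of_exp_eq (X := ℝ) (u := fun t ↦ L (circleMap x R t))
    (v := fun t ↦ -(t * Complex.I) - Complex.log R) (s := univ) isPreconnected_univ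
    (hL.comp (continuous_circleMap x R).continuousOn fun t _ ↦ hm t) (by fun_prop)
    (fun t _ ↦ by
      rw [hL' _ (hm t), hf _ (hm t), Complex.exp_sub, Complex.exp_neg, Complex.exp_log hR',
        circleMap_sub_center, circleMap_zero, mul_inv, mul_comm, div_eq_mul_inv])
    (mem_univ 0) (mem_univ (2 * Real.pi))
  have hper : circleMap x R (2 * Real.pi) = circleMap x R 0 := by
    simpa using periodic_circleMap x R 0
  rw [hper] at key
  refine Complex.two_pi_I_ne_zero ?_
  push_cast at key
  linear_combination -key

/-- If `(z - x) / (z - y)` has a continuous logarithm off the disjoint union of two compact sets,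
then `x` and `y` cannot be in different ones of the two. -/
theorem not_isLogOn_div_of_disjoint {x y : ℂ} {K₁ K₂ : Set ℂ} {L : ℂ → ℂ} (hK₁ : IsCompact K₁)
    (hK₂ : IsCompact K₂) (hd : Disjoint K₁ K₂) (hx : x ∈ K₁) (hy : y ∈ K₂) :
    ¬ IsLogOn L (fun z ↦ (z - x) / (z - y)) (K₁ ∪ K₂)ᶜ := by
  rintro ⟨hL, hL'⟩
  obtain ⟨R, hR, hKR⟩ := hK₁.isBounded.subset_ball_lt 0 x
  have hT : IsClosed (K₂ ∪ (ball x R)ᶜ) := hK₂.isClosed.union isOpen_ball.isClosed_compl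
  obtain ⟨φ, hφT, hφK, -⟩ := exists_continuous_zero_one_of_isClosed hT hK₁.isClosed
    (disjoint_union_left.2 ⟨hd.symm, disjoint_compl_left_iff_subset.2 hKR⟩)
  let ψ : ℂ → ℝ := fun z ↦ max 0 (min 1 (3 * φ z - 1))
  have hψ : Continuous ψ := by fun_prop
  have hU₀ : IsOpen {z | φ z < 1 / 3} := isOpen_lt φ.continuous continuous_const
  have hU₁ : IsOpen {z | 2 / 3 < φ z} := isOpen_lt continuous_const φ.continuous
  have hψ₀ : ∀ z, φ z < 1 / 3 → ψ z = 0 := fun z hz ↦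
    max_eq_left ((min_le_right _ _).trans (by linarith))
  have hψ₁ : ∀ z, 2 / 3 < φ z → ψ z = 1 := fun z hz ↦ by
    simp only [ψ]
    rw [min_eq_left (by linarith), max_eq_right zero_le_one]
  have h₁ : ∀ z ∈ K₁, 2 / 3 < φ z := fun z hz ↦ by rw [hφK hz]; norm_num
  have h₂ : ∀ z ∈ K₂, φ z < 1 / 3 := fun z hz ↦ by rw [hφT (Or.inl hz)]; norm_num
  classical
  -- `G` passes from `1 / (z - y)` near `K₁` to `1 / (z - x)` near `K₂` and far away, so it avoids
  -- both poles. Being continuous and zero-free on the plane, it has a logarithm, which the winding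
  -- on a large circle forbids.
  let G : ℂ → ℂ := fun z ↦ if 2 / 3 < φ z then (z - y)⁻¹ else Complex.exp (ψ z * L z) / (z - x)
  have ne_x : ∀ z, ¬ 2 / 3 < φ z → z - x ≠ 0 := fun z hz e ↦
    hz (h₁ z (sub_eq_zero.1 e ▸ hx))
  have ne_y : ∀ z, ¬ φ z < 1 / 3 → z - y ≠ 0 := fun z hz e ↦
    hz (h₂ z (sub_eq_zero.1 e ▸ hy))
  have hG₀ : ∀ z, φ z < 1 / 3 → G z = (z - x)⁻¹ := fun z hz ↦ by
    have : ¬ 2 / 3 < φ z := by linarith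
    simp [G, this, hψ₀ z hz]
  have hG₁ : ∀ z, 2 / 3 < φ z → G z = (z - y)⁻¹ := fun z hz ↦ if_pos hz
  have hG : ∀ z ∈ (K₁ ∪ K₂)ᶜ, z - x ≠ 0 ∧ G z = Complex.exp (ψ z * L z) / (z - x) := by
    intro z hz
    have hzx : z - x ≠ 0 := fun e ↦ hz (Or.inl (sub_eq_zero.1 e ▸ hx))
    refine ⟨hzx, ?_⟩
    by_cases h : 2 / 3 < φ z
    · rw [hG₁ z h, hψ₁ z h, Complex.ofReal_one, one_mul, hL' z hz]
      field_simp
    · exact if_neg h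
  have hGc : Continuous G := by
    refine continuous_iff_continuousAt.2 fun z ↦ ?_
    by_cases hz₁ : 2 / 3 < φ z
    · refine ContinuousAt.congr (f := fun w ↦ (w - y)⁻¹) ?_ ?_
      · exact ContinuousAt.inv₀ (by fun_prop) (ne_y z (by linarith))
      · filter_upwards [hU₁.mem_nhds hz₁] with w hw using (hG₁ w hw).symm
    by_cases hz₂ : φ z < 1 / 3
    · refine ContinuousAt.congr (f := fun w ↦ (w - x)⁻¹) ?_ ?_
      · exact ContinuousAt.inv₀ (by fun_prop) (ne_x z hz₁)
      · filter_upwards [hU₀.mem_nhds hz₂] with w hw using (hG₀ w hw).symm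
    have hzK : z ∈ (K₁ ∪ K₂)ᶜ := fun h ↦ h.elim (fun h ↦ hz₁ (h₁ z h)) fun h ↦ hz₂ (h₂ z h)
    have hK : (K₁ ∪ K₂)ᶜ ∈ 𝓝 z := (hK₁.union hK₂).isClosed.isOpen_compl.mem_nhds hzK
    refine ContinuousAt.congr (f := fun w ↦ Complex.exp (ψ w * L w) / (w - x)) ?_ ?_
    · have hLz := hL.continuousAt hK
      refine ContinuousAt.div ?_ (by fun_prop) (ne_x z hz₁)
      fun_prop
    · filter_upwards [hK] with w hw using (hG w hw).2.symm
  have hG0 : ∀ z, G z ≠ 0 := by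
    intro z
    by_cases hz : 2 / 3 < φ z
    · rw [hG₁ z hz]
      exact inv_ne_zero (ne_y z (by linarith))
    · simp only [G, if_neg hz]
      exact div_ne_zero (Complex.exp_ne_zero _) (ne_x z hz)
  have hsc : IsSimplyConnected (univ : Set ℂ) :=
    (Homeomorph.Set.univ ℂ).toHomotopyEquiv.simplyConnectedSpace
  obtain ⟨M, hM, hM'⟩ := Complex.exists_continuousOn_eqOn_exp_comp hsc isOpen_univ
    hGc.continuousOn (by simpa using hG0)
  refine not_isLogOn_inv_sub (x := x) (f := G) hR (fun z hz ↦ hG₀ z ?_)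
    ⟨hM.mono (subset_univ _), fun z _ ↦ hM' (mem_univ z)⟩
  rw [hφT (Or.inr (by simp [hz]))]
  norm_num

/-- If `(z - x) / (z - y)` has a continuous logarithm off a compact set containing `x` and `y`,
then `x` and `y` lie in the same component of the set. -/
theorem IsLogOn.mem_connectedComponentIn {x y : ℂ} {K : Set ℂ} {L : ℂ → ℂ} (hK : IsCompact K)
    (hx : x ∈ K) (hy : y ∈ K) (hL : IsLogOn L (fun z ↦ (z - x) / (z - y)) Kᶜ) :
    y ∈ connectedComponentIn K x := by
  have := isCompact_iff_compactSpace.1 hK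
  rw [connectedComponentIn_eq_image hx]
  refine ⟨⟨y, hy⟩, ?_, rfl⟩
  -- In a compact Hausdorff space components are intersections of clopen sets.
  rw [connectedComponent_eq_iInter_isClopen, mem_iInter]
  rintro ⟨Z, hZ, hxZ⟩
  by_contra hyZ
  refine not_isLogOn_div_of_disjoint (K₁ := (↑) '' Z) (K₂ := (↑) '' Zᶜ)
    (hZ.1.isCompact.image continuous_subtype_val)
    (hZ.compl.1.isCompact.image continuous_subtype_val)
    ((disjoint_image_iff Subtype.val_injective).2 disjoint_compl_right)
    (L := L) (mem_image_of_mem _ hxZ) (mem_image_of_mem _ (mem_compl hyZ)) ?_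
  rwa [← image_union, union_compl_self, image_univ, Subtype.range_coe]

/-! ### Inner uniform domains -/

theorem infEDist_frontier_le_edist {E : Type*} [NormedAddCommGroup E] [NormedSpace ℝ E]
    [FiniteDimensional ℝ E] {Ω : Set E} {p x : E} (hp : p ∈ Ω) (hx : x ∉ Ω) :
    infEDist p (frontier Ω) ≤ edist p x := by
  obtain ⟨q, hq, hqd⟩ := exists_mem_frontier_infDist_compl_eq_dist hp
    (fun h : Ω = univ ↦ hx (h ▸ mem_univ x))
  refine (infEDist_le_edist_of_mem hq).trans ?_
  rw [edist_dist, edist_dist, ← hqd]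
  exact ENNReal.ofReal_le_ofReal (infDist_le_dist_of_mem hx)

/-- A point on an inner uniform curve with endpoints far from a point `x` outside the domain cannot
be close to `x`. -/
theorem IsInnerUniformCurve.lt_dist {A : ℝ} (hA : 0 ≤ A) {Ω : Set ℂ} {a b x : ℂ} {γ : Path a b}
    (hγ : IsInnerUniformCurve A Ω γ) (hx : x ∉ Ω) {r : ℝ} (ha : (A + 1) * r < dist a x)
    (hb : (A + 1) * r < dist b x) (t : unitInterval) : r < dist (γ t) x := by
  by_contra! hle
  have h1 : ENNReal.ofReal A * infEDist (γ t) (frontier Ω) ≤ ENNReal.ofReal (A * r) := by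
    rw [ENNReal.ofReal_mul hA]
    gcongr
    refine (infEDist_frontier_le_edist (hγ.mem t) hx).trans ?_
    rw [edist_dist]
    exact ENNReal.ofReal_le_ofReal hle
  have h2 : ENNReal.ofReal (dist a (γ t)) ≤ curveLengthOn γ 0 t := by
    rw [← edist_dist]
    simpa [curveLengthOn] using eVariationOn.edist_le γ (s := Icc 0 t) (left_mem_Icc.2 t.2.1)
      (right_mem_Icc.2 t.2.1)
  have h3 : ENNReal.ofReal (dist (γ t) b) ≤ curveLengthOn γ t 1 := by
    rw [← edist_dist]
    simpa [curveLengthOn] using eVariationOn.edist_le γ (s := Icc t 1) (left_mem_Icc.2 t.2.2)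
      (right_mem_Icc.2 t.2.2)
  have h4 := (min_le_min h2 h3).trans ((hγ.cigar t).trans h1)
  have hr : 0 ≤ A * r := mul_nonneg hA (dist_nonneg.trans hle)
  have t1 := dist_triangle a (γ t) x
  have t2 := dist_triangle b (γ t) x
  rw [dist_comm b (γ t)] at t2
  rcases min_le_iff.1 h4 with h | h
  · have := (ENNReal.ofReal_le_ofReal_iff hr).1 h
    linarith
  · have := (ENNReal.ofReal_le_ofReal_iff hr).1 h
    linarith

theorem IsInnerUniformDomain.mem_connectedComponentIn {A : ℝ} (hA : 0 ≤ A) {Ω S : Set ℂ}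
    (hΩ : IsInnerUniformDomain A Ω) (hS : IsPreconnected S) (hSΩ : S ⊆ Ωᶜ) {x y : ℂ}
    (hx : x ∈ S) (hy : y ∈ S) {ρ : ℝ} (hρ : (A + 1) * dist x y < ρ) :
    y ∈ connectedComponentIn (Ωᶜ ∩ closedBall x ρ) x := by
  have hr : dist x y < ρ := by nlinarith [dist_nonneg (x := x) (y := y)]
  obtain ⟨L, hL⟩ := exists_isLogOn_div_of_isOpen hΩ.isOpen hΩ.isConnected hS hSΩ hx hy
  have hM := isLogOn_log_div x y
  set M : ℂ → ℂ := fun z ↦ Complex.log ((z - x) / (z - y)) with hMdef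
  have hseg : ∀ z, dist x y < dist z x → z ∈ (segment ℝ x y)ᶜ := fun z hz h ↦ by
    have : z ∈ closedBall x (dist x y) := (convex_closedBall x _).segment_subset
      (mem_closedBall_self dist_nonneg) (by simp [dist_comm]) h
    exact absurd hz (not_lt.2 this)
  have hab : ∀ a ∈ Ω, ∀ b ∈ Ω, ρ ≤ dist a x → ρ ≤ dist b x → L a - M a = L b - M b := by
    intro a ha b hb hax hbx
    obtain ⟨γ, hγ⟩ := hΩ.exists_curve a ha b hb
    have hd := hγ.lt_dist hA (hSΩ hx) (hρ.trans_le hax) (hρ.trans_le hbx)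
    have h1 : range γ ⊆ Ω := range_subset_iff.2 hγ.mem
    have h2 : range γ ⊆ (segment ℝ x y)ᶜ := range_subset_iff.2 fun t ↦ hseg _ (hd t)
    exact sub_eq_sub_of_exp_eq (isPreconnected_range γ.continuous) (hL.1.mono h1) (hM.1.mono h2)
      (fun z hz ↦ by rw [hL.2 z (h1 hz), hM.2 z (h2 hz)]) ⟨0, γ.source⟩ ⟨1, γ.target⟩
  obtain ⟨c, hc, hc'⟩ : ∃ c, Complex.exp c = 1 ∧ ∀ a ∈ Ω, ρ ≤ dist a x → L a - M a = c := by
    by_cases h : ∃ a ∈ Ω, ρ ≤ dist a x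
    · obtain ⟨a, ha, hax⟩ := h
      refine ⟨L a - M a, ?_, fun b hb hbx ↦ hab b hb a ha hbx hax⟩
      rw [Complex.exp_sub, hL.2 a ha, hM.2 a (hseg a (hr.trans_le hax))]
      exact div_self (Complex.slitPlane_ne_zero (div_mem_slitPlane (hseg a (hr.trans_le hax))))
    · exact ⟨0, Complex.exp_zero, fun a ha hax ↦ (h ⟨a, ha, hax⟩).elim⟩
  classical
  -- Points off `Ω` where `N` must be continuous lie outside the closed ball, where the two formulas
  -- agree on `Ω`.
  let N : ℂ → ℂ := fun z ↦ if z ∈ Ω then L z else M z + c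
  have hNΩ : ∀ z ∈ Ω, N z = L z := fun z hz ↦ if_pos hz
  have hNM : ∀ z, ρ ≤ dist z x → N z = M z + c := fun z hz ↦ by
    by_cases h : z ∈ Ω
    · rw [hNΩ z h, ← hc' z h hz]
      ring
    · exact if_neg h
  have hyd : y ∈ closedBall x ρ := by simpa [dist_comm] using hr.le
  refine IsLogOn.mem_connectedComponentIn (L := N)
    ((isCompact_closedBall x ρ).inter_left hΩ.isOpen.isClosed_compl)
    ⟨hSΩ hx, mem_closedBall_self (dist_nonneg.trans hr.le)⟩ ⟨hSΩ hy, hyd⟩ ⟨?_, ?_⟩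
  · intro z hz
    refine ContinuousAt.continuousWithinAt ?_
    by_cases h : z ∈ Ω
    · refine (hL.1.continuousAt (hΩ.isOpen.mem_nhds h)).congr ?_
      filter_upwards [hΩ.isOpen.mem_nhds h] with w hw using (hNΩ w hw).symm
    · have hzρ : z ∈ (closedBall x ρ)ᶜ := fun h' ↦ hz ⟨h, h'⟩
      have hnb : (closedBall x ρ)ᶜ ∈ 𝓝 z := isClosed_closedBall.isOpen_compl.mem_nhds hzρ
      have hlt : ∀ w ∈ (closedBall x ρ)ᶜ, ρ < dist w x := fun w hw ↦ by simpa using hw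
      have hMc : ContinuousAt M z := hM.1.continuousAt
        (mem_of_superset hnb fun w hw ↦ hseg w (hr.trans (hlt w hw)))
      refine (hMc.add_const c).congr ?_
      filter_upwards [hnb] with w hw using (hNM w (hlt w hw).le).symm
  · intro z hz
    by_cases h : z ∈ Ω
    · rw [hNΩ z h, hL.2 z h]
    · have hlt : ρ < dist z x := by
        by_contra! h'
        exact hz ⟨h, h'⟩
      rw [hNM z hlt.le, Complex.exp_add, hc, mul_one, hM.2 z (hseg z (hr.trans hlt))]

theorem theorem2p3 (A : ℝ) (hA : 1 ≤ A) :
    ∃ C : ℝ, ∀ Ω : Set ℂ, IsInnerUniformDomain A Ω →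
      ∀ z ∈ Ωᶜ, HasBoundedTurning C (connectedComponentIn Ωᶜ z) := by
  -- `A + 2` gives the strict inequality `ρ > (A + 1) * dist x y`; the factor 2 turns radius into
  -- diameter.
  refine ⟨2 * (A + 2), fun Ω hΩ z hz ↦ ⟨by linarith, ?_⟩⟩
  set S := connectedComponentIn Ωᶜ z with hSdef
  have hS : S ⊆ Ωᶜ := connectedComponentIn_subset _ _
  intro x y
  rcases eq_or_ne x y with rfl | hxy
  · exact ⟨{x}, isConnected_singleton, rfl, rfl, by simp⟩
  have hd : 0 < dist (x : ℂ) y := by rwa [← Subtype.dist_eq, dist_pos]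
  set ρ := (A + 2) * dist (x : ℂ) y with hρ
  have hρ0 : 0 ≤ ρ := by positivity
  set E := connectedComponentIn (Ωᶜ ∩ closedBall (x : ℂ) ρ) x
  have hxE : (x : ℂ) ∈ E := mem_connectedComponentIn ⟨hS x.2, mem_closedBall_self hρ0⟩
  have hyE : (y : ℂ) ∈ E := hΩ.mem_connectedComponentIn (zero_le_one.trans hA)
    isPreconnected_connectedComponentIn hS x.2 y.2 (by nlinarith)
  have hEsub : E ⊆ Ωᶜ ∩ closedBall (x : ℂ) ρ := connectedComponentIn_subset _ _
  have hES : E ⊆ S := by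
    rw [hSdef, connectedComponentIn_eq x.2]
    exact connectedComponentIn_mono _ inter_subset_left
  have himg : ((↑) : S → ℂ) '' ((↑) ⁻¹' E) = E := by
    rw [Subtype.image_preimage_coe, inter_eq_right.2 hES]
  refine ⟨(Subtype.val : S → ℂ) ⁻¹' E, ⟨⟨x, hxE⟩, ?_⟩, hxE, hyE, ?_⟩
  · rw [← IsInducing.subtypeVal.isPreconnected_image, himg]
    exact isPreconnected_connectedComponentIn
  · rw [← isometry_subtype_coe.ediam_image, himg]
    refine (ediam_mono (hEsub.trans inter_subset_right)).trans ?_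
    rw [← Metric.closedEBall_ofReal hρ0]
    refine ediam_closedEBall_le.trans ?_
    rw [Subtype.dist_eq, mul_assoc, ← hρ, ENNReal.ofReal_mul zero_le_two]
    simp
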